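/- **Proposition 6.3.** Let $p$ be a prime and let $q=p^f$ with $f\ge 1$, where $f\ge 2$ if $p=2$. Let $\Gamma=(\mathcal V,\mathcal E)$ be a digraph: $\mathcal V$ is a finite set and $\mathcal E\subseteq\mathcal V\times\mathcal V\smallsetminus\{(x,x)\mid x\in\mathcal V\}$. A pair $(x,y)\in\mathcal E$ is called a directed edge if $(y,x)\notin\mathcal E$, and $x,y$ are joined by an undirected edge if $(x,y),(y,x)\in\mathcal E$. Let $G$ be the oriented right-angled Artin pro-$p$ group associated to $\Gamma$ and $q$, that is, the quotient of the free pro-$p$ group on $\mathcal V$ by the closed normal subgroup generated by the elements $[x,y]$ for every undirected edge joining $x$ and $y$, and $[y,x]x^{-q}$ for every directed edge $(x,y)$, where $[a,b]=aba^{-1}b^{-1}$. For $x\in\mathcal V$ let $x^\ast\in \mathrm H^1(G,\mathbb F_p)=\mathrm{Hom}(G,\mathbb F_p)$ be the continuous homomorphism with $x^\ast(x)=1$ and $x^\ast(y)=0$ for every vertex $y\ne x$. Suppose that $\Gamma$ has vertices $u,v,w$ such that $(u,w)$ is a directed edge; $u$ and $v$ are adjacent (at least one of $(u,v),(v,u)$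 belongs to $\mathcal E$); and either $(w,v)$ is a directed edge or $w$ and $v$ are joined by an undirected edge. Put $\alpha=u^\ast+v^\ast$. Then the $q$-fold Massey product $$\langle\underbrace{\alpha,\ldots,\alpha}_{q\text{ times}}\rangle\subseteq \mathrm H^2(G,\mathbb F_p)$$ is essential, i.e., it is non-empty and does not contain $0$. Here, for $n\ge 2$ and $\alpha_1,\dots,\alpha_n\in\mathrm H^1(G,\mathbb F_p)$, the Massey product $\langle\alpha_1,\ldots,\alpha_n\rangle$ is the set of the classes in $\mathrm H^2(G,\mathbb F_p)$ of the 2-cocycles $\sum_{0<r<n}a_{0,r}\smallsmile a_{r,n}$, where $(a_{i,j})$, $0\le i<j\le n$, $(i,j)\ne(0,n)$, runs through the families of continuous 1-cochains $G\to\mathbb F_p$ such that $a_{i-1,i}=\alpha_i$ for $1\le i\le n$ and $\partial a_{i,j}=\sum_{i<r<j}a_{i,r}\smallsmile a_{r,j}$ for all such $i,j$ (with $(\partial a)(g,h)=a(h)-a(gh)+a(g)$ and $(a\smallsmile b)(g,h)=a(g)b(h)$). -/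

import Mathlib

/-! ### Digraphs -/

namespace Digraph

variable {V : Type*}

/-- `(x, y)` is a directed edge: `(x, y)` is an edge and `(y, x)` is not. -/
def IsDirectedEdge (Γ : Digraph V) (x y : V) : Prop := Γ.Adj x y ∧ ¬ Γ.Adj y x

/-- `x` and `y` are joined by an undirected edge: both `(x, y)` and `(y, x)` are edges. -/
def IsUndirectedEdge (Γ : Digraph V) (x y : V) : Prop := Γ.Adj x y ∧ Γ.Adj y x

/-- `x` and `y` are adjacent: at least one of `(x, y)` and `(y, x)` is an edge. -/
def IsJoined (Γ : Digraph V) (x y : V) : Prop := Γ.Adj x y ∨ Γ.Adj y x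

end Digraph

/-! ### The free pro-`p` group on a finite set -/

/-- The normal subgroups of `p`-power index of the free group on `V`. -/
def PPowerIndexSubgroup (p : ℕ) (V : Type*) : Type _ :=
  {N : Subgroup (FreeGroup V) // N.Normal ∧ ∃ k : ℕ, N.index = p ^ k}

namespace PPowerIndexSubgroup

variable {p : ℕ} {V : Type*}

instance (N : PPowerIndexSubgroup p V) : N.1.Normal := N.2.1

/-- The finite quotients `FreeGroup V ⧸ N` carry the discrete topology. -/
instance (N : PPowerIndexSubgroup p V) : TopologicalSpace (FreeGroup V ⧸ N.1) := ⊥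

instance (N : PPowerIndexSubgroup p V) : DiscreteTopology (FreeGroup V ⧸ N.1) := ⟨rfl⟩

end PPowerIndexSubgroup

/-- The free pro-`p` group on the finite set `V`, with the topology induced from the product:
the inverse limit of the (discrete, finite) quotients of the free group on `V` by its normal
subgroups of `p`-power index, as a subgroup of the product of these quotients. -/
def FreeProP (p : ℕ) (V : Type*) :
    Subgroup ((N : PPowerIndexSubgroup p V) → FreeGroup V ⧸ N.1) where
  carrier := {x | ∀ (M N : PPowerIndexSubgroup p V) (h : M.1 ≤ N.1),
    QuotientGroup.map M.1 N.1 (MonoidHom.id _) h (x M) = x N}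
  mul_mem' {x y} hx hy M N h := by
    simp only [Pi.mul_apply, map_mul, hx M N h, hy M N h]
  one_mem' M N h := by simp only [Pi.one_apply, map_one]
  inv_mem' {x} hx M N h := by simp only [Pi.inv_apply, map_inv, hx M N h]

namespace FreeProP

variable {p : ℕ} {V : Type*}

/-- The canonical map from the free group to the free pro-`p` group. -/
def ofFreeGroup (p : ℕ) (V : Type*) : FreeGroup V →* FreeProP p V where
  toFun x := ⟨fun N => QuotientGroup.mk' N.1 x, fun _ _ _ => rfl⟩
  map_one' := rfl
  map_mul' _ _ := rfl

/-- The free generator attached to `x : V`. -/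
def of (p : ℕ) {V : Type*} (x : V) : FreeProP p V := ofFreeGroup p V (FreeGroup.of x)

/-- The continuous projection of the free pro-`p` group onto `FreeGroup V ⧸ N`. -/
def proj (N : PPowerIndexSubgroup p V) : FreeProP p V →ₜ* FreeGroup V ⧸ N.1 where
  toFun x := x.1 N
  map_one' := rfl
  map_mul' _ _ := rfl
  continuous_toFun := (continuous_apply N).comp continuous_subtype_val

end FreeProP

/-! ### Oriented pro-`p` RAAGs -/

section RAAG

variable {V : Type*}

/-- The defining relators, in the free pro-`p` group: `[x, y]` for each undirected edge, and
`[y, x] x⁻ᵠ` for each directed edge `(x, y)`, where `[a, b] = a b a⁻¹ b⁻¹`. -/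
def orientedRelators (p q : ℕ) (Γ : Digraph V) : Set (FreeProP p V) :=
  {r | ∃ x y, Γ.IsUndirectedEdge x y ∧
    r = FreeProP.of p x * FreeProP.of p y * (FreeProP.of p x)⁻¹ * (FreeProP.of p y)⁻¹} ∪
  {r | ∃ x y, Γ.IsDirectedEdge x y ∧
    r = FreeProP.of p y * FreeProP.of p x * (FreeProP.of p y)⁻¹ * (FreeProP.of p x)⁻¹ *
      (FreeProP.of p x ^ q)⁻¹}

/-- The closed normal subgroup generated by the relators. -/
def orientedRelations (p q : ℕ) (Γ : Digraph V) : Subgroup (FreeProP p V) :=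
  (Subgroup.normalClosure (orientedRelators p q Γ)).topologicalClosure

instance (p q : ℕ) (Γ : Digraph V) : (orientedRelations p q Γ).Normal :=
  Subgroup.is_normal_topologicalClosure _

/-- The oriented right-angled Artin pro-`p` group associated to `Γ` and `q`, with the quotient
topology. -/
abbrev OrientedRAAG (p q : ℕ) (Γ : Digraph V) : Type _ :=
  FreeProP p V ⧸ orientedRelations p q Γ

/-- The element of the oriented pro-`p` RAAG given by a vertex. -/
def OrientedRAAG.vertex (p q : ℕ) (Γ : Digraph V) (x : V) : OrientedRAAG p q Γ :=
  QuotientGroup.mk (FreeProP.of p x)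

end RAAG

/-! ### `𝔽_p`-cohomology in degrees 1 and 2 and Massey products

Cochains are continuous inhomogeneous cochains with values in the trivial discrete module
`ZMod p`. -/

section Cohomology

variable (p : ℕ) (G : Type*) [Group G] [TopologicalSpace G] [IsTopologicalGroup G]

/-- The coboundary `C¹(G) → C²(G)`, `(∂a)(g, h) = a(h) - a(gh) + a(g)`. -/
def cobd1 : C(G, ZMod p) →+ C(G × G, ZMod p) where
  toFun a := ⟨fun x => a x.2 - a (x.1 * x.2) + a x.1, by fun_prop⟩
  map_zero' := by ext; simp
  map_add' a b := by ext; simp; ring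

/-- The coboundary `C²(G) → C³(G)`,
`(∂c)(g, h, k) = c(h, k) - c(gh, k) + c(g, hk) - c(g, h)`. -/
def cobd2 : C(G × G, ZMod p) →+ C(G × G × G, ZMod p) where
  toFun c := ⟨fun x => c (x.2.1, x.2.2) - c (x.1 * x.2.1, x.2.2) + c (x.1, x.2.1 * x.2.2)
    - c (x.1, x.2.1), by fun_prop⟩
  map_zero' := by ext; simp
  map_add' a b := by ext; simp; ring

/-- `H¹(G, 𝔽_p)`: the 1-cocycles, that is, the continuous homomorphisms from `G` to the additive
group `ZMod p` (the action is trivial, so every 1-coboundary is zero). -/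
abbrev H1 : Type _ := (cobd1 p G).ker

/-- `H²(G, 𝔽_p)`: the 2-cocycles modulo the 2-coboundaries. -/
abbrev H2 : Type _ := (cobd2 p G).ker ⧸ (cobd1 p G).range.addSubgroupOf (cobd2 p G).ker

variable {p G}

/-- The cup product of two 1-cochains, `(a ⌣ b)(g, h) = a(g) b(h)`. -/
def cup (a b : C(G, ZMod p)) : C(G × G, ZMod p) := ⟨fun x => a x.1 * b x.2, by fun_prop⟩

/-- A defining system for the `n`-fold Massey product `⟨α₁, …, αₙ⟩` is an array of 1-cochains
`a i j` (only the entries with `0 ≤ i < j ≤ n` and `(i, j) ≠ (0, n)` matter) such that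
`a (i-1) i` represents `αᵢ` and `∂ (a i j) = ∑_{i < r < j} a i r ⌣ a r j`. -/
structure IsDefiningSystem {n : ℕ} (α : Fin n → H1 p G)
    (a : Fin (n + 1) → Fin (n + 1) → C(G, ZMod p)) : Prop where
  diag : ∀ i : Fin n, a i.castSucc i.succ = α i
  cobd : ∀ i j : Fin (n + 1), i < j → (i, j) ≠ (0, Fin.last n) →
    cobd1 p G (a i j) = ∑ r ∈ Finset.Ioo i j, cup (a i r) (a r j)

/-- The 2-cochain attached to a defining system. -/
def masseyCochain {n : ℕ} (a : Fin (n + 1) → Fin (n + 1) → C(G, ZMod p)) : C(G × G, ZMod p) :=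
  ∑ r ∈ Finset.Ioo 0 (Fin.last n), cup (a 0 r) (a r (Fin.last n))

theorem cobd2_cup (a b : C(G, ZMod p)) (g h k : G) :
    cobd2 p G (cup a b) (g, h, k) = cobd1 p G a (g, h) * b k - a g * cobd1 p G b (h, k) := by
  simp only [cobd2, cobd1, cup, AddMonoidHom.coe_mk, ZeroHom.coe_mk, ContinuousMap.coe_mk]
  ring

/-- The 2-cochain attached to a defining system is a cocycle. -/
theorem IsDefiningSystem.masseyCochain_mem {n : ℕ} {α : Fin n → H1 p G}
    {a : Fin (n + 1) → Fin (n + 1) → C(G, ZMod p)} (ha : IsDefiningSystem α a) :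
    masseyCochain a ∈ (cobd2 p G).ker := by
  rw [AddMonoidHom.mem_ker]
  ext ⟨g, h, k⟩
  have h1 : ∀ r ∈ Finset.Ioo 0 (Fin.last n), cobd2 p G (cup (a 0 r) (a r (Fin.last n))) (g, h, k) =
      (∑ s ∈ Finset.Ioo 0 r, a 0 s g * a s r h * a r (Fin.last n) k) -
      ∑ s ∈ Finset.Ioo r (Fin.last n), a 0 r g * a r s h * a s (Fin.last n) k := by
    intro r hr
    rw [Finset.mem_Ioo] at hr
    rw [cobd2_cup, ha.cobd 0 r hr.1 (fun e => hr.2.ne (congrArg Prod.snd e)),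
      ha.cobd r _ hr.2 (fun e => hr.1.ne' (congrArg Prod.fst e))]
    simp [cup, ContinuousMap.sum_apply, Finset.sum_mul, Finset.mul_sum, mul_assoc]
  rw [masseyCochain, map_sum, ContinuousMap.sum_apply, Finset.sum_congr rfl h1,
    Finset.sum_sub_distrib, ContinuousMap.zero_apply, sub_eq_zero]
  refine Finset.sum_comm' fun x y => ?_
  simp only [Finset.mem_Ioo]
  exact ⟨fun h => ⟨⟨h.2.2, h.1.2⟩, h.2.1, h.2.2.trans h.1.2⟩,
    fun h => ⟨⟨h.2.1.trans h.1.1, h.1.2⟩, h.2.1, h.1.1⟩⟩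

/-- The value in `H²(G, 𝔽_p)` of a defining system. -/
def IsDefiningSystem.value {n : ℕ} {α : Fin n → H1 p G}
    {a : Fin (n + 1) → Fin (n + 1) → C(G, ZMod p)} (ha : IsDefiningSystem α a) : H2 p G :=
  QuotientAddGroup.mk ⟨masseyCochain a, ha.masseyCochain_mem⟩

/-- The `n`-fold Massey product `⟨α₁, …, αₙ⟩ ⊆ H²(G, 𝔽_p)` (for `n ≥ 2`): the set of values of
all its defining systems. -/
def masseyProduct {n : ℕ} (α : Fin n → H1 p G) : Set (H2 p G) :=
  {x | ∃ (a : Fin (n + 1) → Fin (n + 1) → C(G, ZMod p)) (ha : IsDefiningSystem α a),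
    ha.value = x}

/-- A Massey product is essential if it is defined (non-empty) and does not vanish (does not
contain `0`). -/
def IsEssentialMassey {n : ℕ} (α : Fin n → H1 p G) : Prop :=
  (masseyProduct α).Nonempty ∧ (0 : H2 p G) ∉ masseyProduct α

end Cohomology

/-! ### The classes dual to the vertices -/

section Dual

variable {V : Type*} (p : ℕ) [Fact p.Prime]

open Classical in
/-- The homomorphism from the free group to `𝔽_p` sending `x` to `1` and every other generator to
`0`. -/
noncomputable def freeDual (x : V) : FreeGroup V →* Multiplicative (ZMod p) :=
  FreeGroup.lift fun y => Multiplicative.ofAdd (if y = x then 1 else 0)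

/-- The kernel of `freeDual p x`, which has index `p`. -/
noncomputable def freeDualKer (x : V) : PPowerIndexSubgroup p V :=
  ⟨(freeDual p x).ker, inferInstance, by
    have hd : Nat.card (freeDual p x).range ∣ p ^ 1 := by
      simpa using Subgroup.card_subgroup_dvd_card (freeDual p x).range
    obtain ⟨k, -, hk⟩ := (Nat.dvd_prime_pow Fact.out).1 hd
    exact ⟨k, by rw [Subgroup.index_ker, hk]⟩⟩

/-- The continuous homomorphism from the free pro-`p` group to `𝔽_p` dual to `x`. -/
noncomputable def freeProPDual (x : V) : FreeProP p V →* Multiplicative (ZMod p) :=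
  (QuotientGroup.kerLift (freeDual p x)).comp (FreeProP.proj (freeDualKer p x)).toMonoidHom

theorem continuous_freeProPDual (x : V) : Continuous (freeProPDual p x) :=
  (continuous_of_discreteTopology (f := fun z : FreeGroup V ⧸ (freeDualKer p x).1 =>
    QuotientGroup.kerLift (freeDual p x) z)).comp (FreeProP.proj (freeDualKer p x)).continuous

open Classical in
theorem freeProPDual_of (x y : V) :
    freeProPDual p x (FreeProP.of p y) = Multiplicative.ofAdd (if y = x then 1 else 0) := by
  have h : freeProPDual p x (FreeProP.of p y) = freeDual p x (FreeGroup.of y) := rfl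
  rw [h, freeDual, FreeGroup.lift_apply_of]

theorem orientedRelations_le_ker {f : ℕ} (hf : 1 ≤ f) (Γ : Digraph V) (x : V) :
    orientedRelations p (p ^ f) Γ ≤ (freeProPDual p x).ker := by
  refine Subgroup.topologicalClosure_minimal _ (Subgroup.normalClosure_le_normal ?_) ?_
  · have hq : ∀ z : Multiplicative (ZMod p), z ^ p ^ f = 1 := fun z => by
      obtain ⟨k, hk⟩ := dvd_pow_self p (Nat.one_le_iff_ne_zero.1 hf)
      have : z ^ p = 1 := by
        rw [← ofAdd_toAdd z, ← ofAdd_nsmul]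
        simp
      rw [hk, pow_mul, this, one_pow]
    rintro r (⟨y, z, -, rfl⟩ | ⟨y, z, -, rfl⟩) <;>
      simp [MonoidHom.mem_ker, mul_comm, hq]
  · exact isClosed_singleton.preimage (continuous_freeProPDual p x)

/-- The dual class `x* ∈ H¹(G, 𝔽_p)` of a vertex `x`, where `G` is the oriented pro-`p` RAAG
associated to `Γ` and `q = p ^ f`, `f ≥ 1`. -/
noncomputable def vertexDual {f : ℕ} (hf : 1 ≤ f) (Γ : Digraph V) (x : V) :
    H1 p (OrientedRAAG p (p ^ f) Γ) :=
  ⟨⟨fun g => (QuotientGroup.lift _ (freeProPDual p x)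
      (orientedRelations_le_ker p hf Γ x) g).toAdd,
    continuous_toAdd.comp ((continuous_freeProPDual p x).quotient_lift _)⟩, by
    rw [AddMonoidHom.mem_ker]
    ext ⟨g, h⟩
    simp only [cobd1, AddMonoidHom.coe_mk, ZeroHom.coe_mk, ContinuousMap.coe_mk, map_mul,
      toAdd_mul, ContinuousMap.zero_apply]
    ring⟩

open Classical in
/-- `x*` takes the value `1` at the vertex `x` and `0` at every other vertex. -/
theorem vertexDual_vertex {f : ℕ} (hf : 1 ≤ f) (Γ : Digraph V) (x y : V) :
    (vertexDual p hf Γ x).1 (OrientedRAAG.vertex p (p ^ f) Γ y) = if y = x then 1 else 0 :=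
  congrArg Multiplicative.toAdd (freeProPDual_of p x y)

end Dual

/-! A value 0 of the Massey product means that the missing corner entry of some defining system can
be filled in, which gives a representation `ρ` of the group by unitriangular matrices of size q + 1
over 𝔽_p with superdiagonal -α (`exists_unipotent_of_zero_mem_masseyProduct`). Let A, B, C be the
images of u, v, w. Then A - 1 and B - 1 are regular nilpotent, while C - 1 starts at the second
superdiagonal.

By Frobenius X^q = 1 + (X - 1)^q, so A^q and B^q are 1 plus a nonzero corner entry and C^q = 1.
Hence C commutes with B, and A, B commute up to the corner. So C - 1 is a polynomial in B - 1
without terms of degree below 2. Powers of B - 1 from the square on commute with A, because B - 1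
kills the corner on both sides (`commute_of_commute`). Thus C commutes with A, and the relation CA =
A^(1+q)C forces A^q = 1, a contradiction.

For non-emptiness, α lifts to θ with values in ℤ/q, since the relators die in an abelian group of
exponent q. The entries of (1 - N)^θ, with N the nilpotent shift, depend only on θ mod q away from
the corner, and give a defining system. -/

namespace Matrix

/-! ### Band matrices and regular unipotents -/

variable {R : Type*} [CommRing R] {n : ℕ}

/-- The matrices whose entries below the `k`-th superdiagonal vanish. -/
def IsBandUpper (k : ℕ) (M : Matrix (Fin n) (Fin n) R) : Prop :=
  ∀ i j : Fin n, (j : ℕ) < i + k → M i j = 0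

namespace IsBandUpper

variable {k l : ℕ} {M N : Matrix (Fin n) (Fin n) R}

theorem mul (hM : M.IsBandUpper k) (hN : N.IsBandUpper l) : (M * N).IsBandUpper (k + l) := by
  intro i j hij
  rw [mul_apply]
  refine Finset.sum_eq_zero fun r _ => ?_
  by_cases hr : (r : ℕ) < i + k
  · rw [hM i r hr, zero_mul]
  · rw [hN r j (by omega), mul_zero]

/-- On the extreme superdiagonal of the product, only one intermediate index survives. -/
theorem mul_apply_eq (hM : M.IsBandUpper k) (hN : N.IsBandUpper l) {i r j : Fin n}
    (hr : (r : ℕ) = i + k) (hj : (j : ℕ) = r + l) : (M * N) i j = M i r * N r j := by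
  rw [mul_apply]
  refine Finset.sum_eq_single r (fun s _ hs => ?_) (by simp)
  have hs' : (s : ℕ) ≠ r := fun h => hs (Fin.ext h)
  by_cases h : (s : ℕ) < i + k
  · rw [hM i s h, zero_mul]
  · rw [hN s j (by omega), mul_zero]

theorem one : (1 : Matrix (Fin n) (Fin n) R).IsBandUpper 0 := by
  intro i j hij
  exact one_apply_ne fun h => by subst h; omega

theorem pow (hM : M.IsBandUpper k) (m : ℕ) : (M ^ m).IsBandUpper (k * m) := by
  induction m with
  | zero => exact one
  | succ m ih => exact (pow_succ M m).symm ▸ ih.mul hM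

theorem eq_zero (hM : M.IsBandUpper k) (hk : n ≤ k) : M = 0 := by
  ext i j
  exact hM i j (by omega)

theorem pow_apply {c : R} (hM : M.IsBandUpper 1)
    (hc : ∀ i j : Fin n, (j : ℕ) = i + 1 → M i j = c) (m : ℕ) (i j : Fin n)
    (hij : (j : ℕ) = i + m) : (M ^ m) i j = c ^ m := by
  induction m generalizing j with
  | zero =>
    obtain rfl : j = i := Fin.ext hij
    simp
  | succ m ih =>
    have hlt : (i : ℕ) + m < n := by omega
    rw [pow_succ, mul_apply_eq (r := ⟨i + m, hlt⟩) (by simpa using hM.pow m) hM rfl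
      (by simpa [add_assoc] using hij), ih ⟨i + m, hlt⟩ rfl,
      hc _ _ (by simpa [add_assoc] using hij), pow_succ]

theorem eq_single {M : Matrix (Fin (n + 1)) (Fin (n + 1)) R} (hM : M.IsBandUpper n) :
    M = single 0 (Fin.last n) (M 0 (Fin.last n)) := by
  ext i j
  by_cases h : i = 0 ∧ j = Fin.last n
  · obtain ⟨rfl, rfl⟩ := h
    simp
  · rw [single_apply, if_neg (by tauto)]
    refine hM i j ?_
    by_contra hlt
    exact h ⟨Fin.ext (by rw [Fin.val_zero]; omega), Fin.ext (by rw [Fin.val_last]; omega)⟩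

/-- The corner lies on the n-th superdiagonal, and one more shift leaves the matrix. -/
theorem single_mul_eq_zero {M : Matrix (Fin (n + 1)) (Fin (n + 1)) R} (hM : M.IsBandUpper 1)
    (c : R) : single (0 : Fin (n + 1)) (Fin.last n) c * M = 0 := by
  refine eq_zero (k := n + 1) (mul (k := n) ?_ hM) le_rfl
  intro i j hij
  refine single_apply_of_ne _ _ _ _ _ ?_
  rintro ⟨rfl, rfl⟩
  simp at hij

theorem mul_single_eq_zero {M : Matrix (Fin (n + 1)) (Fin (n + 1)) R} (hM : M.IsBandUpper 1)
    (c : R) : M * single (0 : Fin (n + 1)) (Fin.last n) c = 0 := by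
  refine eq_zero (k := 1 + n) (mul hM (l := n) ?_) (by omega)
  intro i j hij
  refine single_apply_of_ne _ _ _ _ _ ?_
  rintro ⟨rfl, rfl⟩
  simp at hij

/-- A matrix commuting with a regular nilpotent upper triangular matrix has constant entries on
its first superdiagonal. -/
theorem exists_superdiag_eq [IsDomain R] {c : R} (hc0 : c ≠ 0) {B D : Matrix (Fin n) (Fin n) R}
    (hB : B.IsBandUpper 1) (hc : ∀ i j : Fin n, (j : ℕ) = i + 1 → B i j = c)
    (hD : D.IsBandUpper k) (hDB : Commute D B) :
    ∃ d : R, ∀ i j : Fin n, (j : ℕ) = i + k → D i j = d := by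
  by_cases hk : k < n
  · refine ⟨D ⟨0, by omega⟩ ⟨k, hk⟩, ?_⟩
    suffices h : ∀ (m : ℕ) (hm : m + k < n),
        D ⟨m, by omega⟩ ⟨m + k, hm⟩ = D ⟨0, by omega⟩ ⟨k, hk⟩ by
      intro i j hij
      rw [← h i (by omega)]
      congr 1
      exact Fin.ext hij
    intro m
    induction m with
    | zero => intro hm; congr 1; exact Fin.ext (zero_add k)
    | succ m ih =>
      intro hm
      rw [← ih (by omega)]
      -- Compare the entries of DB and BD at (m, m + 1 + k): each is a single product, and the
      -- factor c cancels.
      have h1 := mul_apply_eq (i := ⟨m, by omega⟩) (r := ⟨m + k, by omega⟩)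
        (j := ⟨m + 1 + k, hm⟩) hD hB rfl (by simp; omega)
      have h2 := mul_apply_eq (i := ⟨m, by omega⟩) (r := ⟨m + 1, by omega⟩)
        (j := ⟨m + 1 + k, hm⟩) hB hD rfl (by simp)
      rw [hDB.eq, h2, hc _ _ (by simp), hc _ _ (by simp; omega), mul_comm] at h1
      exact mul_right_cancel₀ hc0 h1
  · exact ⟨0, fun i j hij => by omega⟩

/-- If `B` is regular nilpotent upper triangular and `[A, B]` is concentrated in the top right
corner, then `A` commutes with everything beyond the first superdiagonal that commutes with `B`. -/
theorem commute_of_commute {K : Type*} [Field K] {c e : K} (hc0 : c ≠ 0)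
    {A B : Matrix (Fin (n + 1)) (Fin (n + 1)) K} (hB : B.IsBandUpper 1)
    (hc : ∀ i j : Fin (n + 1), (j : ℕ) = i + 1 → B i j = c)
    (hAB : A * B = B * A + single 0 (Fin.last n) e) {k : ℕ} (hk : 2 ≤ k)
    {D : Matrix (Fin (n + 1)) (Fin (n + 1)) K} (hD : D.IsBandUpper k) (hDB : Commute D B) :
    Commute D A := by
  -- The error term in AB = BA + corner disappears after one more multiplication by B on either
  -- side.
  have hBA : ∀ m, Commute (B ^ (m + 2)) A := by
    intro m
    induction m with
    | zero =>
      change B ^ 2 * A = A * B ^ 2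
      rw [pow_two, ← mul_assoc A, hAB, add_mul, hB.single_mul_eq_zero, add_zero,
        mul_assoc B A B, hAB, mul_add, hB.mul_single_eq_zero, add_zero, mul_assoc]
    | succ m ih =>
      change B ^ (m + 1 + 2) * A = A * B ^ (m + 1 + 2)
      rw [show m + 1 + 2 = (m + 2) + 1 by ring, pow_succ', ← mul_assoc A, hAB, add_mul, mul_assoc,
        ih.eq, mul_assoc, pow_succ' B (m + 1), ← mul_assoc (single _ _ _),
        hB.single_mul_eq_zero, zero_mul, add_zero]
  -- Induct on the number of superdiagonals left: subtracting a multiple of B^k clears the leading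
  -- one of D.
  induction h : n + 1 - k generalizing k D with
  | zero => exact (hD.eq_zero (by omega)) ▸ Commute.zero_left A
  | succ m ih =>
    obtain ⟨d, hd⟩ := exists_superdiag_eq hc0 hB hc hD hDB
    obtain ⟨l, rfl⟩ := Nat.exists_eq_add_of_le' hk
    have hsub : (D - (d / c ^ (l + 2)) • B ^ (l + 2)).IsBandUpper (l + 2 + 1) := by
      intro i j hij
      rw [sub_apply, smul_apply, smul_eq_mul]
      rcases Nat.lt_succ_iff_lt_or_eq.1 (show (j : ℕ) < (i + (l + 2)) + 1 by omega) with h' | h'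
      · rw [hD i j h', (by simpa using hB.pow (l + 2) : (B ^ (l + 2)).IsBandUpper (l + 2)) i j h']
        simp
      · rw [hd i j h', hB.pow_apply hc _ i j h', div_mul_cancel₀ _ (pow_ne_zero _ hc0), sub_self]
    have hcomm := ih (by omega) hsub
      (hDB.sub_left (((Commute.refl B).pow_left _).smul_left _)) (by omega)
    simpa using hcomm.add_left ((hBA l).smul_left (d / c ^ (l + 2)))

end IsBandUpper

/-- Regular unipotent matrices of size `q + 1` over a field of characteristic `p`, `q = p ^ f`,
admit no solution of the relations of an oriented RAAG on a triangle whose third generator maps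
beyond the first superdiagonal. -/
theorem false_of_unipotent_triangle {K : Type*} [Field K] (p : ℕ) [Fact p.Prime] [CharP K p]
    {f : ℕ} {c : K} (hc0 : c ≠ 0)
    {A B C : Matrix (Fin (p ^ f + 1)) (Fin (p ^ f + 1)) K}
    (hA : (A - 1).IsBandUpper 1)
    (hAc : ∀ i j : Fin (p ^ f + 1), (j : ℕ) = i + 1 → (A - 1) i j = c)
    (hB : (B - 1).IsBandUpper 1)
    (hBc : ∀ i j : Fin (p ^ f + 1), (j : ℕ) = i + 1 → (B - 1) i j = c)
    (hC : (C - 1).IsBandUpper 2)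
    (hCA : C * A = A ^ (1 + p ^ f) * C)
    (hAB : A * B = B * A ∨ B * A = A ^ (1 + p ^ f) * B ∨ A * B = B ^ (1 + p ^ f) * A)
    (hBC : B * C = C * B ∨ B * C = C ^ (1 + p ^ f) * B) : False := by
  have hpow : ∀ X : Matrix (Fin (p ^ f + 1)) (Fin (p ^ f + 1)) K,
      X ^ p ^ f = 1 + (X - 1) ^ p ^ f := by
    intro X
    conv_lhs => rw [show X = 1 + (X - 1) by abel, add_pow_char_pow_of_commute _ _
      (Commute.one_left _), one_pow]
  have hreg : ∀ X : Matrix (Fin (p ^ f + 1)) (Fin (p ^ f + 1)) K, (X - 1).IsBandUpper 1 →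
      (∀ i j : Fin (p ^ f + 1), (j : ℕ) = i + 1 → (X - 1) i j = c) →
      X ^ (1 + p ^ f) = X + single 0 (Fin.last _) (c ^ p ^ f) := by
    intro X h1 h2
    have h3 : (X - 1) ^ p ^ f = single 0 (Fin.last _) (c ^ p ^ f) := by
      have h4 : ((X - 1) ^ p ^ f).IsBandUpper (p ^ f) := by simpa using h1.pow (p ^ f)
      rw [h4.eq_single, h1.pow_apply h2 (p ^ f) 0 (Fin.last _) (by simp)]
    have h5 := h1.mul_single_eq_zero (c ^ p ^ f)
    rw [sub_mul, one_mul, sub_eq_zero] at h5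
    rw [pow_add, pow_one, hpow, h3, mul_add, mul_one, h5]
  have hE : ∀ X : Matrix (Fin (p ^ f + 1)) (Fin (p ^ f + 1)) K, (X - 1).IsBandUpper 1 →
      single (0 : Fin (p ^ f + 1)) (Fin.last (p ^ f)) (c ^ p ^ f) * X =
        single 0 (Fin.last _) (c ^ p ^ f) := by
    intro X h1
    have h5 := h1.single_mul_eq_zero (c ^ p ^ f)
    rwa [mul_sub, mul_one, sub_eq_zero] at h5
  have hC1 : (C - 1).IsBandUpper 1 := fun i j hij => hC i j (by omega)
  -- (C - 1)^q starts at superdiagonal 2q ≥ q + 1, so it vanishes.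
  have hCq : C ^ (1 + p ^ f) = C := by
    have hpos : 0 < p ^ f := pow_pos (Fact.out : p.Prime).pos f
    rw [pow_add, pow_one, hpow, (hC.pow (p ^ f)).eq_zero (by omega), add_zero, mul_one]
  have hBC' : C * B = B * C := by
    rcases hBC with h | h
    · exact h.symm
    · rw [h, hCq]
  -- In all three cases the q-th power contributes only a corner entry, which unitriangular factors
  -- leave unchanged.
  have hAB' : ∃ e, A * B = B * A + single 0 (Fin.last _) e := by
    rcases hAB with h | h | h
    · exact ⟨0, by simp [h]⟩
    · refine ⟨-(c ^ p ^ f), ?_⟩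
      rw [h, hreg A hA hAc, add_mul, hE B hB, add_assoc, ← single_add]
      simp
    · refine ⟨c ^ p ^ f, ?_⟩
      rw [h, hreg B hB hBc, add_mul, hE A hA]
  obtain ⟨e, he⟩ := hAB'
  have hcomm : Commute (C - 1) (A - 1) := by
    refine IsBandUpper.commute_of_commute hc0 (e := e) hB hBc ?_ le_rfl hC ?_
    · simp only [sub_mul, mul_sub, he, mul_one, one_mul]
      abel
    · change (C - 1) * (B - 1) = (B - 1) * (C - 1)
      simp only [sub_mul, mul_sub, hBC', mul_one, one_mul]
      abel
  have hCA' : C * A = A * C := by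
    have h := (hcomm.add_left (Commute.one_left _)).add_right (Commute.one_right _)
    simpa using h.eq
  rw [hreg A hA hAc, add_mul, hE C hC1, hCA', left_eq_add] at hCA
  have h0 := congrFun (congrFun hCA 0) (Fin.last _)
  rw [single_apply_same] at h0
  exact pow_ne_zero _ hc0 h0

end Matrix

/-! ### Defining systems and unipotent matrices -/

section Unipotent

variable {p : ℕ} {G : Type*} [TopologicalSpace G] {n : ℕ}

/-- The upper unitriangular matrix with entries `-a i j g` above the diagonal. -/
def unipotentMatrix (a : Fin n → Fin n → C(G, ZMod p)) (g : G) :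
    Matrix (Fin n) (Fin n) (ZMod p) :=
  Matrix.of fun i j => if i < j then -a i j g else if i = j then 1 else 0

theorem unipotentMatrix_sub_one_apply (a : Fin n → Fin n → C(G, ZMod p)) (g : G) (i j : Fin n) :
    (unipotentMatrix a g - 1) i j = if i < j then -a i j g else 0 := by
  rw [Matrix.sub_apply, unipotentMatrix, Matrix.of_apply, Matrix.one_apply]
  split_ifs with h1 h2 h2 <;> simp_all

theorem isBandUpper_unipotentMatrix_sub_one (a : Fin n → Fin n → C(G, ZMod p)) (g : G) :
    (unipotentMatrix a g - 1).IsBandUpper 1 := by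
  intro i j hij
  rw [unipotentMatrix_sub_one_apply, if_neg]
  rw [Fin.lt_def]
  omega

variable [Group G] [IsTopologicalGroup G]

/-- The minus signs turn ∂a = ∑ a ⌣ a, with a(gh) entering ∂a negatively, into the rule for matrix
multiplication. -/
theorem unipotentMatrix_mul {a : Fin n → Fin n → C(G, ZMod p)}
    (ha : ∀ i j, i < j → cobd1 p G (a i j) = ∑ r ∈ Finset.Ioo i j, cup (a i r) (a r j))
    (g h : G) : unipotentMatrix a (g * h) = unipotentMatrix a g * unipotentMatrix a h := by
  suffices hs : unipotentMatrix a (g * h) - 1 = (unipotentMatrix a g - 1) +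
      (unipotentMatrix a h - 1) + (unipotentMatrix a g - 1) * (unipotentMatrix a h - 1) by
    rw [sub_eq_iff_eq_add] at hs
    rw [hs]
    noncomm_ring
  ext i j
  simp only [Matrix.add_apply, Matrix.mul_apply, unipotentMatrix_sub_one_apply]
  have hsum : ∑ r, (if i < r then -a i r g else 0) * (if r < j then -a r j h else 0) =
      ∑ r ∈ Finset.Ioo i j, a i r g * a r j h := by
    rw [← Finset.sum_subset (Finset.subset_univ (Finset.Ioo i j))]
    · refine Finset.sum_congr rfl fun r hr => ?_
      rw [Finset.mem_Ioo] at hr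
      rw [if_pos hr.1, if_pos hr.2, neg_mul_neg]
    · intro r _ hr
      rw [Finset.mem_Ioo, not_and_or] at hr
      rcases hr with hr | hr <;> simp [hr]
  rw [hsum]
  split_ifs with hij
  · have h1 := congrArg (fun φ : C(G × G, ZMod p) => φ (g, h)) (ha i j hij)
    simp only [cobd1, cup, AddMonoidHom.coe_mk, ZeroHom.coe_mk, ContinuousMap.coe_mk,
      ContinuousMap.sum_apply] at h1
    rw [← h1]
    ring
  · rw [Finset.Ioo_eq_empty hij]
    simp

/-- If the Massey product of `α` contains `0`, there is a unipotent representation of `G` with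
superdiagonal `-α`. -/
theorem exists_unipotent_of_zero_mem_masseyProduct {α : Fin n → H1 p G} (hn : 2 ≤ n)
    (h0 : (0 : H2 p G) ∈ masseyProduct α) :
    ∃ ρ : G →* Matrix (Fin (n + 1)) (Fin (n + 1)) (ZMod p),
      (∀ g, (ρ g - 1).IsBandUpper 1) ∧
      ∀ g (i : Fin n), (ρ g - 1) i.castSucc i.succ = -(α i).1 g := by
  obtain ⟨a, ha, hv⟩ := h0
  rw [IsDefiningSystem.value, QuotientAddGroup.eq_zero_iff, AddSubgroup.mem_addSubgroupOf] at hv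
  obtain ⟨b, hb⟩ := hv
  -- A primitive b of the Massey cocycle fills the corner. No cup product in the other equations
  -- involves that entry.
  let a' : Fin (n + 1) → Fin (n + 1) → C(G, ZMod p) := fun i j =>
    if (i, j) = (0, Fin.last n) then b else a i j
  have ha' : ∀ i j, i < j → cobd1 p G (a' i j) = ∑ r ∈ Finset.Ioo i j, cup (a' i r) (a' r j) := by
    intro i j hij
    have hsum : ∑ r ∈ Finset.Ioo i j, cup (a' i r) (a' r j) =
        ∑ r ∈ Finset.Ioo i j, cup (a i r) (a r j) := by
      refine Finset.sum_congr rfl fun r hr => ?_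
      rw [Finset.mem_Ioo] at hr
      have h1 : r ≠ Fin.last n := (hr.2.trans_le (Fin.le_last j)).ne
      have h2 : r ≠ 0 := ((Fin.zero_le i).trans_lt hr.1).ne'
      simp [a', h1, h2]
    rw [hsum]
    by_cases h : (i, j) = (0, Fin.last n)
    · simp only [a', if_pos h]
      obtain ⟨rfl, rfl⟩ := Prod.mk.inj h
      exact hb
    · simp only [a', if_neg h]
      exact ha.cobd i j hij h
  have hmul := unipotentMatrix_mul ha'
  have hone : unipotentMatrix a' 1 = 1 := by
    have hdet : (unipotentMatrix a' 1).det = 1 := by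
      rw [Matrix.det_of_isUpperTriangular]
      · simp [unipotentMatrix]
      · intro i j hij
        have hij' : j < i := hij
        simp [unipotentMatrix, hij'.not_gt, hij'.ne']
    -- An invertible idempotent is 1.
    have hu : IsUnit (unipotentMatrix a' 1) := (Matrix.isUnit_iff_isUnit_det _).2 (by simp [hdet])
    refine hu.mul_left_cancel ?_
    rw [← hmul, mul_one, mul_one]
  refine ⟨⟨⟨unipotentMatrix a', hone⟩, hmul⟩, isBandUpper_unipotentMatrix_sub_one a', ?_⟩
  intro g i
  have hne : (i.castSucc, i.succ) ≠ ((0 : Fin (n + 1)), Fin.last n) := by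
    intro h
    rw [Prod.mk.injEq, Fin.ext_iff, Fin.ext_iff] at h
    simp at h
    omega
  change (unipotentMatrix a' g - 1) _ _ = _
  rw [unipotentMatrix_sub_one_apply, if_pos Fin.castSucc_lt_succ]
  simp only [a', if_neg hne, ha.diag]

end Unipotent

/-! ### Defining systems from binomial coefficients -/

section Binomial

/-- Modulo p, (X + 1)^m is (X + 1)^(m mod q) times a power of X^q + 1, which is 1 modulo X^q, so
coefficients below degree q agree. -/
theorem cast_choose_mod_prime_pow {p : ℕ} [Fact p.Prime] {f k : ℕ} (hk : k < p ^ f) (m : ℕ) :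
    ((m % p ^ f).choose k : ZMod p) = (m.choose k : ZMod p) := by
  conv_rhs => rw [← Nat.mod_add_div m (p ^ f)]
  rw [← Polynomial.coeff_X_add_one_pow (ZMod p) (m % p ^ f), ← Polynomial.coeff_X_add_one_pow,
    pow_add, pow_mul, add_pow_char_pow, one_pow]
  obtain ⟨P, hP⟩ : (Polynomial.X ^ p ^ f : Polynomial (ZMod p)) ∣
      (Polynomial.X ^ p ^ f + 1) ^ (m / p ^ f) - 1 := by
    have h := sub_dvd_pow_sub_pow (Polynomial.X ^ p ^ f + 1 : Polynomial (ZMod p)) 1 (m / p ^ f)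
    rwa [one_pow, show (Polynomial.X ^ p ^ f + 1 - 1 : Polynomial (ZMod p)) =
      Polynomial.X ^ p ^ f by ring] at h
  rw [sub_eq_iff_eq_add] at hP
  rw [hP, mul_add, mul_one, Polynomial.coeff_add, mul_left_comm, Polynomial.coeff_X_pow_mul',
    if_neg (by omega), zero_add]

/-- The function `t ↦ (-1) ^ k * binom t k` modulo `p`, on integers modulo `p ^ f`. -/
def signedChoose (p f k : ℕ) (t : ZMod (p ^ f)) : ZMod p := (-1) ^ k * (t.val.choose k : ZMod p)

variable {p : ℕ} [Fact p.Prime] {f : ℕ}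

/-- This is Vandermonde's identity; k < q makes the reduction of s + t mod q harmless. -/
theorem signedChoose_add {k : ℕ} (hk : k < p ^ f) (s t : ZMod (p ^ f)) :
    signedChoose p f k (s + t) = ∑ x ∈ Finset.HasAntidiagonal.antidiagonal k,
      signedChoose p f x.1 s * signedChoose p f x.2 t := by
  have : NeZero (p ^ f) := ⟨(pow_pos (Fact.out : p.Prime).pos f).ne'⟩
  rw [signedChoose, ZMod.val_add, cast_choose_mod_prime_pow hk, Nat.add_choose_eq, Nat.cast_sum,
    Finset.mul_sum]
  refine Finset.sum_congr rfl fun x hx => ?_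
  rw [← Finset.HasAntidiagonal.mem_antidiagonal.1 hx, signedChoose, signedChoose, Nat.cast_mul, pow_add]
  ring

theorem signedChoose_add_succ {k : ℕ} (hk : k + 1 < p ^ f) (s t : ZMod (p ^ f)) :
    signedChoose p f (k + 1) (s + t) = signedChoose p f (k + 1) s + signedChoose p f (k + 1) t +
      ∑ m ∈ Finset.range k, signedChoose p f (m + 1) s * signedChoose p f (k - m) t := by
  have h0 : ∀ t, signedChoose p f 0 t = 1 := fun t => by simp [signedChoose]
  rw [signedChoose_add hk, Finset.Nat.sum_antidiagonal_eq_sum_range_succ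
    (fun i j => signedChoose p f i s * signedChoose p f j t), Finset.sum_range_succ,
    Finset.sum_range_succ']
  simp only [h0, Nat.sub_self, Nat.sub_zero, Nat.add_sub_add_right, mul_one, one_mul]
  ring

/-- If `α` lifts to a homomorphism to `ℤ / p ^ f`, its `p ^ f`-fold Massey power is defined. -/
theorem masseyProduct_nonempty_of_lift {G : Type*} [Group G] [TopologicalSpace G]
    [IsTopologicalGroup G] (α : H1 p G) (θ : C(G, ZMod (p ^ f)))
    (hθ : ∀ g h, θ (g * h) = θ g + θ h) (hα : ∀ g, α.1 g = ((θ g).val : ZMod p)) :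
    (masseyProduct fun _ : Fin (p ^ f) => α).Nonempty := by
  let a : Fin (p ^ f + 1) → Fin (p ^ f + 1) → C(G, ZMod p) := fun i j =>
    ⟨fun g => -signedChoose p f (j - i) (θ g),
      (continuous_of_discreteTopology
        (f := fun t : ZMod (p ^ f) => -signedChoose p f (j - i) t)).comp θ.continuous⟩
  have ha : IsDefiningSystem (fun _ : Fin (p ^ f) => α) a := by
    constructor
    · intro i
      ext g
      simp [a, signedChoose, hα]
    · intro i j hij hne
      ext ⟨g, h⟩
      obtain ⟨k, hk⟩ := Nat.exists_eq_add_of_lt (Fin.lt_def.1 hij)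
      -- Distance q occurs only at the excluded corner.
      have hkq : k + 1 < p ^ f := by
        by_contra hlt
        refine hne (Prod.ext (Fin.ext ?_) (Fin.ext ?_))
        · change (i : ℕ) = 0
          omega
        · change (j : ℕ) = p ^ f
          omega
      have hsum : ∑ r ∈ Finset.Ioo i j, a i r g * a r j h =
          ∑ m ∈ Finset.range k, signedChoose p f (m + 1) (θ g) *
            signedChoose p f (k - m) (θ h) := by
        have h1 := Finset.sum_map (Finset.Ioo i j) Fin.valEmbedding (fun r : ℕ =>
          signedChoose p f (r - i) (θ g) * signedChoose p f (j - r) (θ h))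
        rw [Fin.map_valEmbedding_Ioo, ← Finset.Ico_add_one_left_eq_Ioo,
          Finset.sum_Ico_eq_sum_range, show (j : ℕ) - (i + 1) = k by omega] at h1
        simp only [a, ContinuousMap.coe_mk, neg_mul_neg]
        refine h1.symm.trans (Finset.sum_congr rfl fun m hm => ?_)
        rw [show (i : ℕ) + 1 + m - i = m + 1 by omega,
          show (j : ℕ) - (i + 1 + m) = k - m by omega]
      simp only [ContinuousMap.sum_apply, cup, ContinuousMap.coe_mk, hsum]
      simp only [cobd1, AddMonoidHom.coe_mk, ZeroHom.coe_mk, ContinuousMap.coe_mk, a, hθ,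
        show (j : ℕ) - i = k + 1 by omega, signedChoose_add_succ hkq]
      ring
  exact ⟨_, a, ha, rfl⟩

end Binomial

/-! ### Lifting the dual classes to `ℤ / p ^ f` -/

section DualLift

variable {V : Type*} (p f : ℕ)

open Classical in
/-- The homomorphism from the free group to `ℤ / p ^ f` sending `x` to `1` and every other
generator to `0`. -/
noncomputable def freeDualLift (x : V) : FreeGroup V →* Multiplicative (ZMod (p ^ f)) :=
  FreeGroup.lift fun y => Multiplicative.ofAdd (if y = x then 1 else 0)

theorem cast_freeDualLift [Fact p.Prime] (hf : 1 ≤ f) (x : V) (g : FreeGroup V) :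
    ZMod.castHom (dvd_pow_self p (Nat.one_le_iff_ne_zero.1 hf)) (ZMod p)
      (freeDualLift p f x g).toAdd = (freeDual p x g).toAdd := by
  have h : (AddMonoidHom.toMultiplicative (ZMod.castHom (dvd_pow_self p
      (Nat.one_le_iff_ne_zero.1 hf)) (ZMod p)).toAddMonoidHom).comp (freeDualLift p f x) =
      freeDual p x := by
    ext y
    simp only [freeDualLift, freeDual, MonoidHom.comp_apply, FreeGroup.lift_apply_of,
      AddMonoidHom.toMultiplicative_apply_apply]
    split_ifs
    · exact map_one (ZMod.castHom (dvd_pow_self p (Nat.one_le_iff_ne_zero.1 hf)) (ZMod p))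
    · exact map_zero (ZMod.castHom (dvd_pow_self p (Nat.one_le_iff_ne_zero.1 hf)) (ZMod p))
  exact congrArg Multiplicative.toAdd (DFunLike.congr_fun h g)

variable [Fact p.Prime]

/-- The kernel of `freeDualLift p f x`, which has index `p ^ f`. -/
noncomputable def freeDualLiftKer (x : V) : PPowerIndexSubgroup p V :=
  ⟨(freeDualLift p f x).ker, inferInstance, by
    have hd : Nat.card (freeDualLift p f x).range ∣ p ^ f := by
      simpa using Subgroup.card_subgroup_dvd_card (freeDualLift p f x).range
    obtain ⟨k, -, hk⟩ := (Nat.dvd_prime_pow Fact.out).1 hd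
    exact ⟨k, by rw [Subgroup.index_ker, hk]⟩⟩

/-- The continuous homomorphism from the free pro-`p` group to `ℤ / p ^ f` dual to `x`. -/
noncomputable def freeProPDualLift (x : V) : FreeProP p V →* Multiplicative (ZMod (p ^ f)) :=
  (QuotientGroup.kerLift (freeDualLift p f x)).comp
    (FreeProP.proj (freeDualLiftKer p f x)).toMonoidHom

theorem continuous_freeProPDualLift (x : V) : Continuous (freeProPDualLift p f x) :=
  (continuous_of_discreteTopology (f := fun z : FreeGroup V ⧸ (freeDualLiftKer p f x).1 =>
    QuotientGroup.kerLift (freeDualLift p f x) z)).comp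
      (FreeProP.proj (freeDualLiftKer p f x)).continuous

/-- The kernel mod q lies in the kernel mod p, so one word g approximating z modulo the smaller
kernel computes both values. -/
theorem cast_freeProPDualLift (hf : 1 ≤ f) (x : V) (z : FreeProP p V) :
    ZMod.castHom (dvd_pow_self p (Nat.one_le_iff_ne_zero.1 hf)) (ZMod p)
      (freeProPDualLift p f x z).toAdd = (freeProPDual p x z).toAdd := by
  have hle : (freeDualLiftKer p f x).1 ≤ (freeDualKer p x).1 := by
    intro g hg
    have hg' : freeDualLift p f x g = 1 := hg
    change freeDual p x g = 1
    have h := cast_freeDualLift p f hf x g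
    rw [hg', toAdd_one, map_zero] at h
    exact h.symm
  obtain ⟨g, hg⟩ := QuotientGroup.mk_surjective (z.1 (freeDualLiftKer p f x))
  have h1 : freeProPDualLift p f x z = freeDualLift p f x g := by
    change QuotientGroup.kerLift (freeDualLift p f x) (z.1 (freeDualLiftKer p f x)) = _
    rw [← hg]
    rfl
  have h2 : freeProPDual p x z = freeDual p x g := by
    change QuotientGroup.kerLift (freeDual p x) (z.1 (freeDualKer p x)) = _
    rw [← z.2 _ _ hle, ← hg]
    rfl
  rw [h1, h2, cast_freeDualLift p f hf]

theorem orientedRelations_le_ker_lift (Γ : Digraph V) (x : V) :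
    orientedRelations p (p ^ f) Γ ≤ (freeProPDualLift p f x).ker := by
  refine Subgroup.topologicalClosure_minimal _ (Subgroup.normalClosure_le_normal ?_) ?_
  · have hq : ∀ z : Multiplicative (ZMod (p ^ f)), z ^ p ^ f = 1 := fun z => by
      rw [← ofAdd_toAdd z, ← ofAdd_nsmul, nsmul_eq_mul, ZMod.natCast_self, zero_mul, ofAdd_zero]
    rintro r (⟨y, z, -, rfl⟩ | ⟨y, z, -, rfl⟩) <;>
      simp [MonoidHom.mem_ker, mul_comm, hq]
  · exact isClosed_singleton.preimage (continuous_freeProPDualLift p f x)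

/-- The lift of the dual class `x*` to a continuous homomorphism to `ℤ / p ^ f`. -/
noncomputable def vertexDualLift (Γ : Digraph V) (x : V) :
    C(OrientedRAAG p (p ^ f) Γ, ZMod (p ^ f)) :=
  ⟨fun g => (QuotientGroup.lift _ (freeProPDualLift p f x)
      (orientedRelations_le_ker_lift p f Γ x) g).toAdd,
    continuous_toAdd.comp ((continuous_freeProPDualLift p f x).quotient_lift _)⟩

theorem vertexDualLift_mul (Γ : Digraph V) (x : V) (g h : OrientedRAAG p (p ^ f) Γ) :
    vertexDualLift p f Γ x (g * h) = vertexDualLift p f Γ x g + vertexDualLift p f Γ x h := by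
  simp only [vertexDualLift, ContinuousMap.coe_mk, map_mul, toAdd_mul]

theorem cast_vertexDualLift (hf : 1 ≤ f) (Γ : Digraph V) (x : V) (g : OrientedRAAG p (p ^ f) Γ) :
    ZMod.castHom (dvd_pow_self p (Nat.one_le_iff_ne_zero.1 hf)) (ZMod p)
      (vertexDualLift p f Γ x g) = (vertexDual p hf Γ x).1 g := by
  obtain ⟨z, rfl⟩ := QuotientGroup.mk_surjective g
  exact cast_freeProPDualLift p f hf x z

end DualLift

/-! ### Relations between the vertices -/

namespace OrientedRAAG

variable {V : Type*} (p q : ℕ) (Γ : Digraph V)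

theorem mk_eq_one_of_mem {r : FreeProP p V} (hr : r ∈ orientedRelators p q Γ) :
    (QuotientGroup.mk r : OrientedRAAG p q Γ) = 1 :=
  (QuotientGroup.eq_one_iff r).2
    (Subgroup.le_topologicalClosure _ (Subgroup.subset_normalClosure hr))

theorem vertex_comm {Γ : Digraph V} {x y : V} (h : Γ.IsUndirectedEdge x y) :
    vertex p q Γ x * vertex p q Γ y = vertex p q Γ y * vertex p q Γ x := by
  have h1 : vertex p q Γ x * vertex p q Γ y * (vertex p q Γ x)⁻¹ * (vertex p q Γ y)⁻¹ = 1 :=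
    mk_eq_one_of_mem p q Γ (Or.inl ⟨x, y, h, rfl⟩)
  rwa [mul_inv_eq_one, mul_inv_eq_iff_eq_mul] at h1

/-- The inverse-free form can be transported by a homomorphism into the multiplicative monoid of
matrices. -/
theorem vertex_conj {Γ : Digraph V} {x y : V} (h : Γ.IsDirectedEdge x y) :
    vertex p q Γ y * vertex p q Γ x = vertex p q Γ x ^ (1 + q) * vertex p q Γ y := by
  have h1 : vertex p q Γ y * vertex p q Γ x * (vertex p q Γ y)⁻¹ * (vertex p q Γ x)⁻¹ *
      (vertex p q Γ x ^ q)⁻¹ = 1 :=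
    mk_eq_one_of_mem p q Γ (Or.inr ⟨x, y, h, rfl⟩)
  rwa [mul_inv_eq_one, mul_inv_eq_iff_eq_mul, mul_inv_eq_iff_eq_mul, ← pow_succ, add_comm q 1]
    at h1

end OrientedRAAG

/-! ### Essentiality of the Massey power -/

theorem proposition6p3 {V : Type*} [Finite V] (p : ℕ) [Fact p.Prime] (f : ℕ) (hf : 1 ≤ f)
    (hf2 : p = 2 → 2 ≤ f) (Γ : Digraph V) (hΓ : ∀ x, ¬ Γ.Adj x x) (u v w : V)
    (huw : Γ.IsDirectedEdge u w) (huv : Γ.IsJoined u v)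
    (hwv : Γ.IsDirectedEdge w v ∨ Γ.IsUndirectedEdge w v) :
    IsEssentialMassey
      (fun _ : Fin (p ^ f) => vertexDual p hf Γ u + vertexDual p hf Γ v) := by
  constructor
  · refine masseyProduct_nonempty_of_lift _ (vertexDualLift p f Γ u + vertexDualLift p f Γ v)
      (fun g h => ?_) fun g => ?_
    · simp only [ContinuousMap.add_apply, vertexDualLift_mul]
      ring
    · have : NeZero (p ^ f) := ⟨(pow_pos (Fact.out : p.Prime).pos f).ne'⟩
      rw [ZMod.natCast_val, ← ZMod.castHom_apply
        (h := dvd_pow_self p (Nat.one_le_iff_ne_zero.1 hf)), ContinuousMap.add_apply, map_add,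
        cast_vertexDualLift, cast_vertexDualLift]
      rfl
  · intro h0
    have hq2 : 2 ≤ p ^ f :=
      (Fact.out : p.Prime).two_le.trans (Nat.le_self_pow (Nat.one_le_iff_ne_zero.1 hf) p)
    obtain ⟨ρ, hρ, hρα⟩ := exists_unipotent_of_zero_mem_masseyProduct hq2 h0
    have hne : ∀ {x y}, Γ.Adj x y → x ≠ y := by
      rintro x y hxy rfl
      exact hΓ x hxy
    have hwu : w ≠ u := (hne huw.1).symm
    have hwv' : w ≠ v := hwv.elim (fun h => hne h.1) fun h => hne h.1
    have huv' : u ≠ v := huv.elim hne fun h => (hne h).symm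
    have hval : ∀ (x : V) (c : ZMod p), (vertexDual p hf Γ u).1 (OrientedRAAG.vertex p _ Γ x) +
        (vertexDual p hf Γ v).1 (OrientedRAAG.vertex p _ Γ x) = c →
        ∀ i j : Fin (p ^ f + 1), (j : ℕ) = i + 1 →
          (ρ (OrientedRAAG.vertex p _ Γ x) - 1) i j = -c := by
      intro x c hc i j hij
      have hi : (i : ℕ) < p ^ f := by omega
      obtain rfl : j = (⟨i, hi⟩ : Fin (p ^ f)).succ := Fin.ext hij
      exact (hρα _ ⟨i, hi⟩).trans (congrArg Neg.neg hc)
    simp only [vertexDual_vertex] at hval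
    -- Here c = -1 because α is 1 at u and at v, and the superdiagonal of `ρ` is -α.
    refine Matrix.false_of_unipotent_triangle (K := ZMod p) p (f := f) (c := -1)
      (A := ρ (OrientedRAAG.vertex p _ Γ u)) (B := ρ (OrientedRAAG.vertex p _ Γ v))
      (C := ρ (OrientedRAAG.vertex p _ Γ w)) (by simp) (hρ _)
      (hval u 1 (by simp [huv'])) (hρ _) (hval v 1 (by simp [huv'.symm])) ?_ ?_ ?_ ?_
    -- As w differs from u and v, α vanishes at w, which clears the first superdiagonal.
    · intro i j hij
      rcases Nat.lt_succ_iff_lt_or_eq.1 (show (j : ℕ) < (i + 1) + 1 by omega) with h | h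
      · exact hρ _ i j h
      · rw [hval w 0 (by simp [hwu, hwv']) i j h, neg_zero]
    · simp only [← map_mul, ← map_pow, OrientedRAAG.vertex_conj p _ huw]
    · simp only [← map_mul, ← map_pow]
      by_cases h1 : Γ.Adj u v <;> by_cases h2 : Γ.Adj v u
      · exact Or.inl (congrArg ρ (OrientedRAAG.vertex_comm p _ ⟨h1, h2⟩))
      · exact Or.inr (Or.inl (congrArg ρ (OrientedRAAG.vertex_conj p _ ⟨h1, h2⟩)))
      · exact Or.inr (Or.inr (congrArg ρ (OrientedRAAG.vertex_conj p _ ⟨h2, h1⟩)))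
      · exact (huv.elim h1 h2).elim
    · simp only [← map_mul, ← map_pow]
      rcases hwv with h | h
      · exact Or.inr (congrArg ρ (OrientedRAAG.vertex_conj p _ h))
      · exact Or.inl (congrArg ρ (OrientedRAAG.vertex_comm p _ h).symm)
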